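/- For $\alpha\in\mathbb{R}$ let $S_\alpha:(0,\infty)^2\to(0,\infty)$ be the Stolarsky mean, defined by $S_\alpha(a,a)=a$ for $a>0$ and, for $a,b>0$ with $a\neq b$, by \[ S_\alpha(a,b)=\Bigl(\frac{b^\alpha-a^\alpha}{\alpha(b-a)}\Bigr)^{\frac{1}{\alpha-1}}\quad(\alpha\notin\{0,1\}), \] \[ S_0(a,b)=\frac{b-a}{\log b-\log a},\qquad S_1(a,b)=\frac1e\exp\Bigl(\frac{b\log b-a\log a}{b-a}\Bigr). \] Let $\alpha\in\mathbb{R}$ be arbitrary and let $f:(0,\infty)\to\mathbb{R}$ be a differentiable function satisfying \[ f(b)-f(a)=(b-a)\,f'\bigl(S_\alpha(a,b)\bigr)\qquad\text{for all } a,b>0 . \] (i) If $\alpha\notin\{0,1\}$, then there exist constants $c_1,c_2,c_3\in\mathbb{R}$ such that $f(x)=c_1x^\alpha+c_2x+c_3$ for all $x>0$. (ii) If $\alpha\in\{0,1\}$, then there exist constants $c_1,c_2,c_3\in\mathbb{R}$ such that $f(x)=c_1x^\alpha\log x+c_2x+c_3$ for all $x>0$. -/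

import Mathlib

/-- The Stolarsky mean `S_α(a, b)` of two positive reals `a` and `b`. -/
noncomputable def stolarskyMean (α a b : ℝ) : ℝ :=
  if a = b then a
  else if α = 0 then (b - a) / (Real.log b - Real.log a)
  else if α = 1 then
    (1 / Real.exp 1) * Real.exp ((b * Real.log b - a * Real.log a) / (b - a))
  else ((b ^ α - a ^ α) / (α * (b - a))) ^ (1 / (α - 1))

open Filter Topology Set

/-! Let `φ = stolarskyPotential α`, so `φ'' = x ^ (α - 2)`. The Stolarsky mean is exactly the mean
value point of `φ`, so `f` and `φ` share their mean value points (`stolarskyPotential_sub`).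
Homogeneity of the mean makes `f` smooth (`contDiffOn_of_stolarskyMean`). Comparing third-order
expansions on the intervals `(x - u, x + u)` as `u → 0` gives `f''' φ'' = φ''' f''`
(`third_deriv_mul_second_deriv_eq`). Hence `f'' / φ''` is constant, and `f` is a multiple of `φ`
plus an affine function. -/

/-! ### The potential and the Stolarsky mean -/

/-- A normalised second primitive of `x ^ (α - 2)` on the positive reals. -/
noncomputable def stolarskyPotential (α x : ℝ) : ℝ :=
  if α = 0 then -Real.log x
  else if α = 1 then x * Real.log x - x
  else x ^ α / (α * (α - 1))

/-- The first derivative of `stolarskyPotential α`. -/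
noncomputable def stolarskyPotentialDeriv (α x : ℝ) : ℝ :=
  if α = 1 then Real.log x else x ^ (α - 1) / (α - 1)

theorem hasDerivAt_stolarskyPotential (α : ℝ) {x : ℝ} (hx : 0 < x) :
    HasDerivAt (stolarskyPotential α) (stolarskyPotentialDeriv α x) x := by
  by_cases h0 : α = 0
  · subst h0
    have h : stolarskyPotential 0 = fun y => -Real.log y := by
      funext y; simp [stolarskyPotential]
    rw [h]
    refine HasDerivAt.congr_deriv ((Real.hasDerivAt_log hx.ne').neg) ?_
    simp [stolarskyPotentialDeriv, Real.rpow_neg_one, div_neg]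
  by_cases h1 : α = 1
  · subst h1
    have h : stolarskyPotential 1 = fun y => y * Real.log y - y := by
      funext y; simp [stolarskyPotential]
    rw [h]
    refine HasDerivAt.congr_deriv ((Real.hasDerivAt_mul_log hx.ne').sub (hasDerivAt_id x)) ?_
    simp [stolarskyPotentialDeriv]
  have h : stolarskyPotential α = fun y => y ^ α / (α * (α - 1)) := by
    funext y; simp [stolarskyPotential, h0, h1]
  rw [h]
  refine HasDerivAt.congr_deriv ((Real.hasDerivAt_rpow_const (p := α) (Or.inl hx.ne')).div_const (α * (α - 1))) ?_
  have h1' : α - 1 ≠ 0 := sub_ne_zero.2 h1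
  simp only [stolarskyPotentialDeriv, h1, if_false]
  field_simp

theorem hasDerivAt_stolarskyPotentialDeriv (α : ℝ) {x : ℝ} (hx : 0 < x) :
    HasDerivAt (stolarskyPotentialDeriv α) (x ^ (α - 2)) x := by
  by_cases h1 : α = 1
  · subst h1
    have h : stolarskyPotentialDeriv 1 = Real.log := by
      funext y; simp [stolarskyPotentialDeriv]
    rw [h]
    refine HasDerivAt.congr_deriv (Real.hasDerivAt_log hx.ne') ?_
    norm_num [Real.rpow_neg_one]
  have h : stolarskyPotentialDeriv α = fun y => y ^ (α - 1) / (α - 1) := by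
    funext y; simp [stolarskyPotentialDeriv, h1]
  rw [h]
  refine HasDerivAt.congr_deriv ((Real.hasDerivAt_rpow_const (p := α - 1) (Or.inl hx.ne')).div_const (α - 1)) ?_
  have h1' : α - 1 ≠ 0 := sub_ne_zero.2 h1
  rw [show α - 1 - 1 = α - 2 by ring]
  field_simp

theorem strictMonoOn_stolarskyPotentialDeriv (α : ℝ) :
    StrictMonoOn (stolarskyPotentialDeriv α) (Ioi 0) := by
  refine strictMonoOn_of_deriv_pos (convex_Ioi 0)
    (fun x hx => (hasDerivAt_stolarskyPotentialDeriv α hx).continuousAt.continuousWithinAt) ?_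
  intro x hx
  rw [interior_Ioi] at hx
  rw [(hasDerivAt_stolarskyPotentialDeriv α hx).deriv]
  exact Real.rpow_pos_of_pos hx _

theorem rpow_sub_rpow_div_pos {α a b : ℝ} (hα : α ≠ 0) (ha : 0 < a) (hab : a < b) :
    0 < (b ^ α - a ^ α) / (α * (b - a)) := by
  rcases hα.lt_or_gt with h | h
  · exact div_pos_of_neg_of_neg (sub_neg.2 (Real.rpow_lt_rpow_of_neg ha hab h))
      (mul_neg_of_neg_of_pos h (sub_pos.2 hab))
  · exact div_pos (sub_pos.2 (Real.rpow_lt_rpow ha.le hab h)) (mul_pos h (sub_pos.2 hab))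

theorem stolarskyMean_pos (α : ℝ) {a b : ℝ} (ha : 0 < a) (hab : a < b) :
    0 < stolarskyMean α a b := by
  unfold stolarskyMean
  rw [if_neg hab.ne]
  split_ifs with h0 h1
  · exact div_pos (sub_pos.2 hab) (sub_pos.2 (Real.log_lt_log ha hab))
  · positivity
  · exact Real.rpow_pos_of_pos (rpow_sub_rpow_div_pos h0 ha hab) _

theorem stolarskyPotential_sub (α : ℝ) {a b : ℝ} (ha : 0 < a) (hab : a < b) :
    stolarskyPotential α b - stolarskyPotential α a =
      (b - a) * stolarskyPotentialDeriv α (stolarskyMean α a b) := by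
  have hba : b - a ≠ 0 := (sub_pos.2 hab).ne'
  by_cases h0 : α = 0
  · subst h0
    have hl : Real.log b - Real.log a ≠ 0 := (sub_pos.2 (Real.log_lt_log ha hab)).ne'
    simp only [stolarskyPotential, stolarskyPotentialDeriv, stolarskyMean, hab.ne, if_true,
      if_false, zero_ne_one, zero_sub, Real.rpow_neg_one]
    field_simp
    ring
  by_cases h1 : α = 1
  · subst h1
    simp only [stolarskyPotential, stolarskyPotentialDeriv, stolarskyMean, hab.ne, if_true,
      if_false, one_ne_zero]
    rw [Real.log_mul (by positivity) (by positivity), Real.log_exp, one_div, Real.log_inv,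
      Real.log_exp]
    field_simp
    ring
  have h1' : α - 1 ≠ 0 := sub_ne_zero.2 h1
  simp only [stolarskyPotential, stolarskyPotentialDeriv, stolarskyMean, hab.ne, h0, h1,
    if_false]
  rw [← Real.rpow_mul (rpow_sub_rpow_div_pos h0 ha hab).le, one_div_mul_cancel h1',
    Real.rpow_one]
  field_simp

/-- The mean value theorem for the potential yields an interior point; injectivity of the derivative
identifies it with the mean. -/
theorem stolarskyMean_mem_Ioo (α : ℝ) {a b : ℝ} (ha : 0 < a) (hab : a < b) :
    stolarskyMean α a b ∈ Ioo a b := by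
  obtain ⟨c, hc, h⟩ := exists_hasDerivAt_eq_slope (stolarskyPotential α)
    (stolarskyPotentialDeriv α) hab
    (fun x hx => (hasDerivAt_stolarskyPotential α
      (ha.trans_le hx.1)).continuousAt.continuousWithinAt)
    (fun x hx => hasDerivAt_stolarskyPotential α (ha.trans hx.1))
  rw [stolarskyPotential_sub α ha hab, mul_div_cancel_left₀ _ (sub_pos.2 hab).ne'] at h
  rwa [← (strictMonoOn_stolarskyPotentialDeriv α).injOn (ha.trans hc.1)
    (stolarskyMean_pos α ha hab) h]

theorem stolarskyMean_mul_left (α : ℝ) {a b t : ℝ} (ha : 0 < a) (hab : a < b) (ht : 0 < t) :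
    stolarskyMean α (t * a) (t * b) = t * stolarskyMean α a b := by
  have hb : 0 < b := ha.trans hab
  have hba : b - a ≠ 0 := (sub_pos.2 hab).ne'
  have hne : t * a ≠ t * b := (mul_lt_mul_of_pos_left hab ht).ne
  unfold stolarskyMean
  rw [if_neg hne, if_neg hab.ne]
  split_ifs with h0 h1
  · rw [Real.log_mul ht.ne' hb.ne', Real.log_mul ht.ne' ha.ne', add_sub_add_left_eq_sub,
      ← mul_sub, mul_div_assoc]
  · rw [Real.log_mul ht.ne' hb.ne', Real.log_mul ht.ne' ha.ne',
      show (t * b * (Real.log t + Real.log b) - t * a * (Real.log t + Real.log a)) /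
        (t * b - t * a) = Real.log t + (b * Real.log b - a * Real.log a) / (b - a) by
          rw [← mul_sub]; field_simp; ring,
      Real.exp_add, Real.exp_log ht]
    ring
  · have h1' : α - 1 ≠ 0 := sub_ne_zero.2 h1
    rw [Real.mul_rpow ht.le hb.le, Real.mul_rpow ht.le ha.le,
      show (t ^ α * b ^ α - t ^ α * a ^ α) / (α * (t * b - t * a)) =
        t ^ (α - 1) * ((b ^ α - a ^ α) / (α * (b - a))) by
          rw [Real.rpow_sub_one ht.ne', ← mul_sub t]; field_simp,
      Real.mul_rpow (Real.rpow_nonneg ht.le _) (rpow_sub_rpow_div_pos h0 ha hab).le,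
      ← Real.rpow_mul ht.le, mul_one_div_cancel h1', Real.rpow_one]

/-! ### Functions sharing their mean value points -/

/-- The symmetric difference quotient to second order. -/
theorem tendsto_symmetric_difference {F F₁ F₂ : ℝ → ℝ} {c x : ℝ}
    (h : ∀ᶠ y in 𝓝 x, HasDerivAt F (F₁ y) y) (h₁ : ∀ᶠ y in 𝓝 x, HasDerivAt F₁ (F₂ y) y)
    (h₂ : HasDerivAt F₂ c x) :
    Tendsto (fun u => (F (x + u) - F (x - u) - 2 * u * F₁ x) / u ^ 3) (𝓝[>] 0) (𝓝 (c / 3)) := by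
  have hadd : Tendsto (fun u : ℝ => x + u) (𝓝[>] 0) (𝓝 x) :=
    ((continuous_const.add continuous_id).tendsto' 0 x (by simp)).mono_left nhdsWithin_le_nhds
  have hsub : Tendsto (fun u : ℝ => x - u) (𝓝[>] 0) (𝓝 x) :=
    ((continuous_const.sub continuous_id).tendsto' 0 x (by simp)).mono_left nhdsWithin_le_nhds
  have hF : ContinuousAt F x := h.self_of_nhds.continuousAt
  have hF₁ : ContinuousAt F₁ x := h₁.self_of_nhds.continuousAt
  have hid : Tendsto (fun u : ℝ => u) (𝓝[>] 0) (𝓝 0) :=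
    tendsto_id.mono_left nhdsWithin_le_nhds
  have hpos : ∀ᶠ u : ℝ in 𝓝[>] 0, 0 < u := self_mem_nhdsWithin
  -- What remains after two uses of l'Hôpital's rule. `F₂` is differentiable only at `x`, so the
  -- limit comes from the definition of the derivative.
  have hlim : Tendsto (fun u => (F₂ (x + u) - F₂ (x - u)) / (6 * u)) (𝓝[>] 0) (𝓝 (c / 3)) := by
    have hd : HasDerivAt (fun u => F₂ (x + u) - F₂ (x - u)) (2 * c) 0 := by
      have e₁ : HasDerivAt (fun u => F₂ (x + u)) c 0 :=
        HasDerivAt.comp_const_add x 0 (by simpa using h₂)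
      have e₂ : HasDerivAt (fun u => F₂ (x - u)) (-c) 0 :=
        HasDerivAt.comp_const_sub x 0 (by simpa using h₂)
      refine HasDerivAt.congr_deriv (e₁.sub e₂) ?_
      ring
    have := (hd.tendsto_slope_zero_right).const_mul (1 / 6)
    rw [show 1 / 6 * (2 * c) = c / 3 by ring] at this
    refine this.congr' ?_
    filter_upwards [hpos] with u hu
    simp only [zero_add, add_zero, sub_zero, sub_self, smul_eq_mul]
    field_simp
  refine HasDerivAt.lhopital_zero_nhdsGT
    (f' := fun u => F₁ (x + u) + F₁ (x - u) - 2 * F₁ x) (g' := fun u => 3 * u ^ 2)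
    ?_ ?_ ?_ ?_ ?_ ?_
  · filter_upwards [hadd.eventually h, hsub.eventually h] with u e₁ e₂
    refine HasDerivAt.congr_deriv (((e₁.comp_const_add x u).sub (e₂.comp_const_sub x u)).sub
      (((hasDerivAt_id u).const_mul 2).mul_const (F₁ x))) ?_
    ring
  · filter_upwards with u
    simpa using hasDerivAt_pow 3 u
  · filter_upwards [hpos] with u hu
    positivity
  · have := ((hF.tendsto.comp hadd).sub (hF.tendsto.comp hsub)).sub
      ((hid.const_mul 2).mul_const (F₁ x))
    simpa using this
  · simpa using hid.pow 3
  refine HasDerivAt.lhopital_zero_nhdsGT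
    (f' := fun u => F₂ (x + u) - F₂ (x - u)) (g' := fun u => 6 * u)
    ?_ ?_ ?_ ?_ ?_ hlim
  · filter_upwards [hadd.eventually h₁, hsub.eventually h₁] with u e₁ e₂
    refine HasDerivAt.congr_deriv (((e₁.comp_const_add x u).add (e₂.comp_const_sub x u)).sub_const (2 * F₁ x)) ?_
    ring
  · filter_upwards with u
    refine HasDerivAt.congr_deriv ((hasDerivAt_pow 2 u).const_mul 3) ?_
    norm_num
    ring
  · filter_upwards [hpos] with u hu
    positivity
  · have := ((hF₁.tendsto.comp hadd).add (hF₁.tendsto.comp hsub)).sub_const (2 * F₁ x)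
    rw [show F₁ x + F₁ x - 2 * F₁ x = 0 by ring] at this
    exact this
  · simpa using (hid.pow 2).const_mul 3

/-- If two functions have the same mean value points `M u ∈ (x - u, x + u)`, then the ratio of
their second derivatives is stationary. -/
theorem third_deriv_mul_second_deriv_eq {F F₁ F₂ G G₁ G₂ M : ℝ → ℝ} {c d x : ℝ}
    (hF : ∀ᶠ y in 𝓝 x, HasDerivAt F (F₁ y) y) (hF₁ : ∀ᶠ y in 𝓝 x, HasDerivAt F₁ (F₂ y) y)
    (hF₂ : HasDerivAt F₂ c x)
    (hG : ∀ᶠ y in 𝓝 x, HasDerivAt G (G₁ y) y) (hG₁ : ∀ᶠ y in 𝓝 x, HasDerivAt G₁ (G₂ y) y)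
    (hG₂ : HasDerivAt G₂ d x)
    (hM : ∀ᶠ u in 𝓝[>] 0, M u ∈ Ioo (x - u) (x + u))
    (hFM : ∀ᶠ u in 𝓝[>] 0, F (x + u) - F (x - u) = 2 * u * F₁ (M u))
    (hGM : ∀ᶠ u in 𝓝[>] 0, G (x + u) - G (x - u) = 2 * u * G₁ (M u)) :
    c * G₂ x = d * F₂ x := by
  have hpos : ∀ᶠ u : ℝ in 𝓝[>] 0, 0 < u := self_mem_nhdsWithin
  obtain ⟨ε, hε, hball⟩ := Metric.eventually_nhds_iff.1 (hF₁.and hG₁)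
  have hsmall : ∀ᶠ u : ℝ in 𝓝[>] 0, u < ε :=
    nhdsWithin_le_nhds (Iio_mem_nhds hε)
  -- Cauchy's mean value theorem between `x` and `M u`. The product form also covers `M u = x`.
  have key : ∀ᶠ u in 𝓝[>] (0 : ℝ), ∃ ξ, |ξ - x| ≤ u ∧
      (F₁ (M u) - F₁ x) * G₂ ξ = (G₁ (M u) - G₁ x) * F₂ ξ := by
    filter_upwards [hM, hpos, hsmall] with u hu hu0 huε
    have hd : ∀ y, |y - x| ≤ u → HasDerivAt F₁ (F₂ y) y ∧ HasDerivAt G₁ (G₂ y) y :=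
      fun y hy => hball (by rw [Real.dist_eq]; exact hy.trans_lt huε)
    rcases lt_trichotomy (M u) x with h | h | h
    · have hI : ∀ y ∈ Icc (M u) x, |y - x| ≤ u := fun y hy =>
        abs_le.2 ⟨by linarith [hu.1, hy.1], by linarith [hy.2]⟩
      obtain ⟨ξ, hξ, e⟩ := exists_ratio_hasDerivAt_eq_ratio_slope F₁ F₂ h
        (fun y hy => (hd y (hI y hy)).1.continuousAt.continuousWithinAt)
        (fun y hy => (hd y (hI y (Ioo_subset_Icc_self hy))).1) G₁ G₂
        (fun y hy => (hd y (hI y hy)).2.continuousAt.continuousWithinAt)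
        (fun y hy => (hd y (hI y (Ioo_subset_Icc_self hy))).2)
      exact ⟨ξ, hI ξ (Ioo_subset_Icc_self hξ), by linarith⟩
    · exact ⟨x, by simpa using hu0.le, by rw [h]; ring⟩
    · have hI : ∀ y ∈ Icc x (M u), |y - x| ≤ u := fun y hy =>
        abs_le.2 ⟨by linarith [hy.1], by linarith [hu.2, hy.2]⟩
      obtain ⟨ξ, hξ, e⟩ := exists_ratio_hasDerivAt_eq_ratio_slope F₁ F₂ h
        (fun y hy => (hd y (hI y hy)).1.continuousAt.continuousWithinAt)
        (fun y hy => (hd y (hI y (Ioo_subset_Icc_self hy))).1) G₁ G₂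
        (fun y hy => (hd y (hI y hy)).2.continuousAt.continuousWithinAt)
        (fun y hy => (hd y (hI y (Ioo_subset_Icc_self hy))).2)
      exact ⟨ξ, hI ξ (Ioo_subset_Icc_self hξ), by linarith⟩
  obtain ⟨ξ, hξ⟩ := key.choice
  have hξx : Tendsto ξ (𝓝[>] 0) (𝓝 x) := by
    rw [tendsto_iff_dist_tendsto_zero]
    refine squeeze_zero' (Eventually.of_forall fun _ => dist_nonneg) ?_
      (tendsto_id.mono_left nhdsWithin_le_nhds : Tendsto (fun u : ℝ => u) (𝓝[>] 0) (𝓝 0))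
    filter_upwards [hξ] with u hu
    rw [Real.dist_eq]
    exact hu.1
  have lF := (tendsto_symmetric_difference hF hF₁ hF₂).mul (hG₂.continuousAt.tendsto.comp hξx)
  have lG := (tendsto_symmetric_difference hG hG₁ hG₂).mul (hF₂.continuousAt.tendsto.comp hξx)
  have heq := tendsto_nhds_unique (lF.congr' ?_) lG
  · linarith
  filter_upwards [hξ, hFM, hGM] with u hu e₁ e₂
  simp only [Function.comp_apply]
  rw [e₁, e₂]
  -- The numerators are `2 * u * (F₁ (M u) - F₁ x)` and its analogue for `G`, so the Cauchy identity
  -- equates the two products.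
  linear_combination (2 * u / u ^ 3) * hu.2

/-- Two functions with equal second derivatives on the positive reals differ by an affine map. -/
theorem exists_eq_mul_add_const_of_second_deriv {F F₁ F₂ G G₁ : ℝ → ℝ}
    (hF : ∀ x, 0 < x → HasDerivAt F (F₁ x) x) (hF₁ : ∀ x, 0 < x → HasDerivAt F₁ (F₂ x) x)
    (hG : ∀ x, 0 < x → HasDerivAt G (G₁ x) x) (hG₁ : ∀ x, 0 < x → HasDerivAt G₁ (F₂ x) x) :
    ∃ p q : ℝ, ∀ x, 0 < x → F x = G x + p * x + q := by
  have const : ∀ H : ℝ → ℝ, (∀ x, 0 < x → HasDerivAt H 0 x) → ∀ x, 0 < x → H x = H 1 :=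
    fun H hH x hx => isOpen_Ioi.is_const_of_deriv_eq_zero (convex_Ioi (0 : ℝ)).isPreconnected
      (fun y hy => (hH y hy).differentiableAt.differentiableWithinAt)
      (fun y hy => (hH y hy).deriv) hx (mem_Ioi.2 one_pos)
  have h₁ := const (fun x => F₁ x - G₁ x) fun x hx => by
    exact ((hF₁ x hx).sub (hG₁ x hx)).congr_deriv (sub_self _)
  have h₀ := const (fun x => F x - G x - (F₁ 1 - G₁ 1) * x) fun x hx => by
    refine HasDerivAt.congr_deriv (((hF x hx).sub (hG x hx)).sub ((hasDerivAt_id x).const_mul (F₁ 1 - G₁ 1))) ?_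
    have := h₁ x hx
    linarith
  refine ⟨F₁ 1 - G₁ 1, F 1 - G 1 - (F₁ 1 - G₁ 1) * 1, fun x hx => ?_⟩
  have := h₀ x hx
  linarith

/-! ### Regularity and the differential equation -/

/-- Since the mean of `t` and `2 * t` is `k * t`, the derivative of `f` is built from dilates of `f`
itself, so each order of smoothness yields the next. -/
theorem contDiffOn_of_stolarskyMean {α : ℝ} {f : ℝ → ℝ} (hf : DifferentiableOn ℝ f (Ioi 0))
    (hmean : ∀ a b : ℝ, 0 < a → 0 < b →
      f b - f a = (b - a) * deriv f (stolarskyMean α a b)) (n : ℕ) :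
    ContDiffOn ℝ n f (Ioi 0) := by
  set k := stolarskyMean α 1 2 with hk
  have hk0 : 0 < k := stolarskyMean_pos α one_pos one_lt_two
  have hderiv : ∀ y ∈ Ioi (0 : ℝ), deriv f y = (f (y / k * 2) - f (y / k * 1)) / (y / k) := by
    intro y hy
    have ht : 0 < y / k := div_pos hy hk0
    have h := hmean (y / k * 1) (y / k * 2) (by positivity) (by positivity)
    rw [stolarskyMean_mul_left α one_pos one_lt_two ht, ← hk, div_mul_cancel₀ _ hk0.ne'] at h
    rw [h, eq_div_iff ht.ne']
    ring
  induction n with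
  | zero => simpa using hf.continuousOn
  | succ n ih =>
    push_cast
    rw [contDiffOn_succ_iff_deriv_of_isOpen isOpen_Ioi]
    refine ⟨hf, by simp, ContDiffOn.congr ?_ hderiv⟩
    have hdil : ∀ r : ℝ, 0 < r → ContDiffOn ℝ n (fun y => f (y / k * r)) (Ioi 0) := fun r hr =>
      ih.comp (by fun_prop) fun y hy => mul_pos (div_pos hy hk0) hr
    exact ((hdil 2 two_pos).sub (hdil 1 one_pos)).div (by fun_prop)
      fun y hy => (div_pos hy hk0).ne'

theorem exists_eq_stolarskyPotential {α : ℝ} {f : ℝ → ℝ} (hf : DifferentiableOn ℝ f (Ioi 0))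
    (hmean : ∀ a b : ℝ, 0 < a → 0 < b →
      f b - f a = (b - a) * deriv f (stolarskyMean α a b)) :
    ∃ c p q : ℝ, ∀ x, 0 < x → f x = c * stolarskyPotential α x + p * x + q := by
  have hC : ContDiffOn ℝ (1 + 1 + 1) f (Ioi 0) := by
    have := contDiffOn_of_stolarskyMean hf hmean 3
    norm_num at this ⊢
    exact this
  have hC₁ := ((contDiffOn_succ_iff_deriv_of_isOpen isOpen_Ioi).1 hC).2.2
  have hC₂ := ((contDiffOn_succ_iff_deriv_of_isOpen isOpen_Ioi).1 hC₁).2.2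
  have diff : ∀ H : ℝ → ℝ, DifferentiableOn ℝ H (Ioi 0) →
      ∀ x, 0 < x → HasDerivAt H (deriv H x) x := fun H hH x hx =>
    (hH.differentiableAt (Ioi_mem_nhds hx)).hasDerivAt
  have d₀ := diff _ hf
  have d₁ := diff _ (hC₁.differentiableOn (by norm_num))
  have d₂ := diff _ (hC₂.differentiableOn (by norm_num))
  have dG₂ : ∀ x : ℝ, 0 < x →
      HasDerivAt (fun y : ℝ => y ^ (α - 2)) ((α - 2) * x ^ (α - 2 - 1)) x :=
    fun x hx => Real.hasDerivAt_rpow_const (Or.inl hx.ne')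
  have hode : ∀ x, 0 < x → deriv (deriv (deriv f)) x * x ^ (α - 2) =
      (α - 2) * x ^ (α - 2 - 1) * deriv (deriv f) x := by
    intro x hx
    have ev : ∀ {P : ℝ → Prop}, (∀ y, 0 < y → P y) → ∀ᶠ y in 𝓝 x, P y := fun h =>
      (eventually_gt_nhds hx).mono h
    have hu : ∀ᶠ u : ℝ in 𝓝[>] 0, 0 < u ∧ u < x :=
      Filter.Eventually.and self_mem_nhdsWithin (nhdsWithin_le_nhds (Iio_mem_nhds hx))
    refine third_deriv_mul_second_deriv_eq (G₂ := fun y => y ^ (α - 2))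
      (M := fun u => stolarskyMean α (x - u) (x + u)) (ev d₀) (ev d₁) (d₂ x hx)
      (ev fun y hy => hasDerivAt_stolarskyPotential α hy)
      (ev fun y hy => hasDerivAt_stolarskyPotentialDeriv α hy) (dG₂ x hx) ?_ ?_ ?_
    · filter_upwards [hu] with u hu
      exact stolarskyMean_mem_Ioo α (by linarith) (by linarith)
    · filter_upwards [hu] with u hu
      rw [hmean (x - u) (x + u) (by linarith) (by linarith)]
      ring
    · filter_upwards [hu] with u hu
      rw [stolarskyPotential_sub α (by linarith) (by linarith : x - u < x + u)]
      ring
  have hquot : ∀ x, 0 < x → HasDerivAt (fun y => deriv (deriv f) y / y ^ (α - 2)) 0 x := by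
    intro x hx
    refine HasDerivAt.congr_deriv ((d₂ x hx).div (dG₂ x hx) (Real.rpow_pos_of_pos hx _).ne') ?_
    rw [hode x hx]
    ring
  have hsecond : ∀ x, 0 < x → deriv (deriv f) x = deriv (deriv f) 1 * x ^ (α - 2) := by
    intro x hx
    have h := isOpen_Ioi.is_const_of_deriv_eq_zero (convex_Ioi (0 : ℝ)).isPreconnected
      (fun y hy => (hquot y hy).differentiableAt.differentiableWithinAt)
      (fun y hy => (hquot y hy).deriv) (mem_Ioi.2 hx) (mem_Ioi.2 one_pos)
    simp only [Real.one_rpow, div_one] at h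
    rw [← h, div_mul_cancel₀ _ (Real.rpow_pos_of_pos hx _).ne']
  obtain ⟨p, q, h⟩ := exists_eq_mul_add_const_of_second_deriv d₀
    (F₂ := fun x => deriv (deriv f) 1 * x ^ (α - 2))
    (fun x hx => by rw [← hsecond x hx]; exact d₁ x hx)
    (fun x hx => (hasDerivAt_stolarskyPotential α hx).const_mul (deriv (deriv f) 1))
    (fun x hx => (hasDerivAt_stolarskyPotentialDeriv α hx).const_mul (deriv (deriv f) 1))
  exact ⟨_, p, q, h⟩

theorem theorem1 (α : ℝ) (f : ℝ → ℝ)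
    (hf : DifferentiableOn ℝ f (Set.Ioi 0))
    (hmean : ∀ a b : ℝ, 0 < a → 0 < b →
      f b - f a = (b - a) * deriv f (stolarskyMean α a b)) :
    ((α ≠ 0 ∧ α ≠ 1) →
      ∃ c₁ c₂ c₃ : ℝ, ∀ x : ℝ, 0 < x → f x = c₁ * x ^ α + c₂ * x + c₃) ∧
    ((α = 0 ∨ α = 1) →
      ∃ c₁ c₂ c₃ : ℝ, ∀ x : ℝ, 0 < x →
        f x = c₁ * x ^ α * Real.log x + c₂ * x + c₃) := by
  obtain ⟨c, p, q, h⟩ := exists_eq_stolarskyPotential hf hmean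
  refine ⟨fun ⟨h0, h1⟩ => ⟨c / (α * (α - 1)), p, q, fun x hx => ?_⟩, ?_⟩
  · rw [h x hx]
    simp only [stolarskyPotential, h0, h1, if_false]
    ring
  · rintro (rfl | rfl)
    · refine ⟨-c, p, q, fun x hx => ?_⟩
      rw [h x hx]
      simp [stolarskyPotential]
    -- For `α = 1` the potential is `x * log x - x`; its linear term is absorbed into the second
    -- constant.
    · refine ⟨c, p - c, q, fun x hx => ?_⟩
      rw [h x hx]
      simp only [stolarskyPotential, one_ne_zero, if_true, if_false, Real.rpow_one]
      ring
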